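/- Let $n\ge 2$. For $\omega\in S^{n-1}$, $p\in\mathbb R$ put $\omega^\perp=\{y\in\mathbb R^n:\langle y,\omega\rangle=0\}$, $H(\omega,p)=\{x\in\mathbb R^n:\langle x,\omega\rangle=p\}$, and let $Rf(\omega,p)=\int_{\omega^\perp}f(p\omega+y)\,dy$ be the classical Radon transform, where $dy$ is $(n-1)$-dimensional Lebesgue measure. **Limit directions.** For $\Omega\subset S^{n-1}$ and $\omega\in\Omega$ let $I(\omega)$ be the set of all limits $\iota=\lim_k\frac{\omega_k-\omega}{|\omega_k-\omega|}$ with $\omega_k\in\Omega\setminus\{\omega\}$, $\omega_k\to\omega$. We call $I(\omega)$ Zariski dense if every homogeneous polynomial vanishing on $I(\omega)$ vanishes on all of $\omega^\perp$. **Decay class.** Let $W\subset S^{n-1}$, $\omega_0\in W$, and let $J\subset\mathbb R$ be an interval. A function $f:\mathbb R^n\to\mathbb R$ belongs to $\mathcal E(\omega_0,W,J)$ if (a) $f$ is continuously differentiable in a neighbourhood of every point of $\bigcup_{\omega\in W,\,p\in J}H(\omega,p)$; (b) for every $p\in J$ and every integer $k\ge0$ there are $\varepsilon>0$ and $C<\infty$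 with $\int_{\omega^\perp}|y|^k\,|f(p'\omega+y)|\,dy\le C$ for all $\omega\in W$ and all $p'\in J$ with $|p'-p|<\varepsilon$; (c) the same as (b) holds with the directional derivative $\partial_\omega f$ in place of $f$; (d) for every $p\in J$ there is $\mu>0$ with $\int_{\omega_0^\perp}|f(p\omega_0+y)|\,e^{\mu|y|}\,dy<\infty$; (e) for every integer $k\ge0$ and every $\eta\in\omega_0^\perp$, put $M(q)=\int_{\omega_0^\perp}\langle y,\eta\rangle^k f(q\omega_0+y)\,dy$; then either $M(q)=0$ for some $q\in J$, or there is a sequence $q_j\in J$ with $q_j\to+\infty$ or $q_j\to-\infty$, $\limsup_j\int_{\omega_0^\perp}|\langle y,\eta\rangle^k f(q_j\omega_0+y)|\,dy<\infty$ and $M(q_j)\to0$. **Decay conditions.** Let $K\subset\mathbb R^n$. We say that $f$ satisfies the decay conditions relative to $\Omega$ and $K$ if for every $\omega_0\in\Omega$ and every $p$ with $H(\omega_0,p)\cap K=\emptyset$ there are an open neighbourhood $U$ of $\omega_0$ and an interval $J\ni p$ with more than one point such that $H(\omega,q)\cap K=\emptyset$ for all $\omega\in\Omega\cap U$, $q\in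 J$, and $f\in\mathcal E(\omega_0,\Omega\cap U,J)$. **Theorem.** Let $\Omega\subset S^{n-1}$ be perfect in the sense that every point of $\Omega$ is a limit point of $\Omega$, and suppose that $I(\omega)$ is Zariski dense for every $\omega\in\Omega$. Let $K\subset\mathbb R^n$ be closed and let $f:\mathbb R^n\to\mathbb R$ satisfy the decay conditions relative to $\Omega$ and $K$. If $Rf(\omega,p)=0$ for all $\omega\in\Omega$ and $p\in\mathbb R$ with $H(\omega,p)\cap K=\emptyset$, then $f\equiv0$ on $K^\#$, the union of all hyperplanes $H(\omega,p)$ with $\omega\in\Omega$ and $H(\omega,p)\cap K=\emptyset$. -/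

import Mathlib

open MeasureTheory Filter Topology

namespace RadonSupport

/-- `ℝⁿ` with its Euclidean structure. -/
abbrev Space (n : ℕ) : Type := EuclideanSpace ℝ (Fin n)

/-- The linear subspace `ω^⊥` of vectors orthogonal to `ω`.  For a unit vector `ω` it is the tangent
space of the unit sphere at `ω`, and it carries its `(n-1)`-dimensional Lebesgue measure `volume`. -/
noncomputable abbrev Perp {n : ℕ} (ω : Space n) : Submodule ℝ (Space n) := (Submodule.span ℝ {ω})ᗮ

/-- The hyperplane `H(ω, p) = {x : ⟨x, ω⟩ = p}`. -/
def hyperplane {n : ℕ} (ω : Space n) (p : ℝ) : Set (Space n) := {x | inner ℝ x ω = p}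

/-- The classical Radon transform of `f`: the integral of `f` over `H(ω, p) = p ω + ω^⊥`
(for a unit vector `ω`) with respect to `(n-1)`-dimensional Lebesgue measure. -/
noncomputable def radon {n : ℕ} (f : Space n → ℝ) (ω : Space n) (p : ℝ) : ℝ :=
  ∫ y : Perp ω, f (p • ω + (y : Space n))

/-- The set `I(ω)` of limit directions of `Ω` at `ω`. -/
def limitDirections {n : ℕ} (Ω : Set (Space n)) (ω : Space n) : Set (Space n) :=
  {ι | ∃ s : ℕ → Space n, (∀ k, s k ∈ Ω ∧ s k ≠ ω) ∧ Tendsto s atTop (𝓝 ω) ∧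
    Tendsto (fun k => ‖s k - ω‖⁻¹ • (s k - ω)) atTop (𝓝 ι)}

/-- A set `I` of tangent vectors at `ω` is Zariski dense: every homogeneous polynomial that vanishes
on `I` vanishes on the whole tangent space `ω^⊥`.  (Every polynomial function on `ω^⊥` is the
restriction of a polynomial on `ℝⁿ`.) -/
def ZariskiDenseAt {n : ℕ} (ω : Space n) (I : Set (Space n)) : Prop :=
  ∀ (d : ℕ) (P : MvPolynomial (Fin n) ℝ), P.IsHomogeneous d →
    (∀ ι ∈ I, MvPolynomial.eval (fun i => ι i) P = 0) →
    ∀ η ∈ Perp ω, MvPolynomial.eval (fun i => η i) P = 0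

/-- The `n`-dimensional decay class with base direction `ω₀`, set of directions `W` and
set of offsets `J`; it restricts `f` on the union of the hyperplanes `H(ω, p)`, `ω ∈ W`, `p ∈ J`. -/
structure DecayClass {n : ℕ} (f : Space n → ℝ) (ω₀ : Space n) (W : Set (Space n)) (J : Set ℝ) :
    Prop where
  /-- (a) `f` is continuously differentiable around every point of these hyperplanes. -/
  contDiffAt : ∀ ω ∈ W, ∀ p ∈ J, ∀ x ∈ hyperplane ω p, ContDiffAt ℝ 1 f x
  /-- (b) `f` decays faster than every polynomial, locally uniformly in `p`, uniformly in `ω`. -/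
  decay : ∀ p ∈ J, ∀ k : ℕ, ∃ ε > 0, ∃ C : NNReal, ∀ p' ∈ J, |p' - p| < ε → ∀ ω ∈ W,
    ∫⁻ y : Perp ω, ‖‖y‖ ^ k * f (p' • ω + (y : Space n))‖ₑ ≤ C
  /-- (c) the same for the derivative of `f` in the normal direction `ω`. -/
  decay_deriv : ∀ p ∈ J, ∀ k : ℕ, ∃ ε > 0, ∃ C : NNReal, ∀ p' ∈ J, |p' - p| < ε → ∀ ω ∈ W,
    ∫⁻ y : Perp ω, ‖‖y‖ ^ k * fderiv ℝ f (p' • ω + (y : Space n)) ω‖ₑ ≤ C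
  /-- (d) exponential decay on the hyperplanes orthogonal to `ω₀`. -/
  exp_decay : ∀ p ∈ J, ∃ μ : ℝ, 0 < μ ∧
    ∫⁻ y : Perp ω₀, ‖f (p • ω₀ + (y : Space n)) * Real.exp (μ * ‖y‖)‖ₑ < ⊤
  /-- (e) each moment over hyperplanes orthogonal to `ω₀` vanishes at some offset `q ∈ J`, or
  tends to `0` along a sequence of offsets in `J` that goes to infinity. -/
  moment : ∀ (k : ℕ) (η : Perp ω₀),
    (∃ q ∈ J, ∫ y : Perp ω₀, (inner ℝ y η) ^ k * f (q • ω₀ + (y : Space n)) = 0) ∨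
    (∃ q : ℕ → ℝ, (∀ j, q j ∈ J) ∧ (Tendsto q atTop atTop ∨ Tendsto q atTop atBot) ∧
      limsup (fun j => ∫⁻ y : Perp ω₀, ‖(inner ℝ y η) ^ k * f (q j • ω₀ + (y : Space n))‖ₑ)
        atTop < ⊤ ∧
      Tendsto (fun j => ∫ y : Perp ω₀, (inner ℝ y η) ^ k * f (q j • ω₀ + (y : Space n)))
        atTop (𝓝 0))

/-- `f` satisfies the `n`-dimensional decay conditions relative to `Ω` and `K`: every hyperplane
`H(ω₀, p)` with `ω₀ ∈ Ω` that avoids `K` lies in a family of hyperplanes `H(ω, q)`, with `ω` in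
a neighbourhood of `ω₀` in `Ω` and `q` in a nondegenerate interval `J` containing `p`, which all
avoid `K` and on which `f` belongs to the decay class with base direction `ω₀`. -/
def DecayConditions {n : ℕ} (f : Space n → ℝ) (Ω K : Set (Space n)) : Prop :=
  ∀ ω₀ ∈ Ω, ∀ p : ℝ, Disjoint (hyperplane ω₀ p) K →
    ∃ (U : Set (Space n)) (J : Set ℝ), IsOpen U ∧ ω₀ ∈ U ∧
      J.OrdConnected ∧ J.Nontrivial ∧ p ∈ J ∧
      (∀ ω ∈ Ω ∩ U, ∀ q ∈ J, Disjoint (hyperplane ω q) K) ∧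
      DecayClass f ω₀ (Ω ∩ U) J

/-- `K^#`: the union of the hyperplanes that avoid `K` and have a normal vector in `Ω`. -/
def sharp {n : ℕ} (Ω K : Set (Space n)) : Set (Space n) :=
  {x | ∃ ω ∈ Ω, ∃ p : ℝ, Disjoint (hyperplane ω p) K ∧ x ∈ hyperplane ω p}

end RadonSupport

namespace RadonSupport

/-! Call a hyperplane admissible if it avoids `K` and has a normal in `Ω`. It suffices that every
moment `∫ ⟨y, η⟩ ^ k f` over every admissible hyperplane vanishes. Exponential decay makes
characteristic functions extend analytically to a strip, where their Taylor coefficients at `0` (the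
moments) determine them, so `f = 0` on the hyperplane (`eq_zero_of_moments_eq_zero`).

The moments vanish by induction on the order, for all admissible hyperplanes at once
(`moment_eq_zero`); order zero is the hypothesis on the Radon transform. Suppose the orders up to
`m` are done, let `ω ∈ Ω`, and let `φ` be a C¹ function supported in a compact interval of offsets.
By Fubini, `∫ φ(⟨x, ω'⟩) ⟨x, ι⟩ ^ m f(x) dx = 0` for all `ω' ∈ Ω` near `ω`. Differentiating in `ω'`
along a sequence in `Ω` with limit direction `ι` at `ω` gives `∫ φ'(⟨x, ω⟩) ⟨x, ι⟩ ^ (m + 1) f(x) dx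
= 0` (`integral_deriv_mul_moment_eq_zero`). The derivative falls on the test function, never on `f`.

So the moment of order `m + 1` in direction `ι`, as a function of the offset, has weak derivative
zero, and it is constant by the du Bois-Reymond lemma. The difference of the moments at two offsets
is a homogeneous polynomial in the direction, so Zariski density carries constancy from the limit
directions to all of `ω^⊥` (`moment_eq_of_lower_moments_eq_zero`). Condition (e) forces the constant
to be zero. -/

/-! ### Fubini for families of parallel hyperplanes. -/

/-- Slicing of `ℝⁿ` by the hyperplanes orthogonal to a unit vector preserves the volume. -/
theorem measurePreserving_slice {n : ℕ} {ω : Space n} (hω : ‖ω‖ = 1) :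
    MeasurePreserving (fun z : ℝ × Perp ω => z.1 • ω + (z.2 : Space n)) := by
  -- The slicing map is the isometry `ℝ ≃ ℝω` (as `ω` is a unit vector) followed by the orthogonal
  -- decomposition along `ℝω` and `ω^⊥`.
  have h1 := (LinearIsometryEquiv.toSpanUnitSingleton (𝕜 := ℝ) ω hω).measurePreserving.prod
    (MeasurePreserving.id (volume : Measure (Perp ω)))
  have h2 := (WithLp.volume_preserving_toLp (Submodule.span ℝ {ω}) (Perp ω)).comp h1
  have h3 := (Submodule.span ℝ {ω}).orthogonalDecomposition.symm.measurePreserving.comp h2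
  refine (congrArg (fun g => MeasurePreserving g volume volume) ?_).mp h3
  funext z
  have h4 := LinearMap.congr_fun (congrArg LinearEquiv.toLinearMap
    (Submodule.toLinearEquiv_orthogonalDecomposition_symm (Submodule.span ℝ {ω})))
    (WithLp.toLp 2 (Prod.map (LinearIsometryEquiv.toSpanUnitSingleton (𝕜 := ℝ) ω hω) id z))
  refine Eq.trans (b := (Submodule.span ℝ {ω}).orthogonalDecomposition.symm.toLinearEquiv
    (WithLp.toLp 2 (Prod.map (LinearIsometryEquiv.toSpanUnitSingleton (𝕜 := ℝ) ω hω) id z)))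
    rfl (Eq.trans h4 ?_)
  simp

theorem continuous_slice {n : ℕ} (ω : Space n) (p : ℝ) :
    Continuous (fun y : Perp ω => p • ω + (y : Space n)) := by fun_prop

theorem inner_slice {n : ℕ} {ω : Space n} (hω : ‖ω‖ = 1) (p : ℝ) (y : Perp ω) :
    inner ℝ (p • ω + (y : Space n)) ω = p := by
  have h : inner ℝ (y : Space n) ω = 0 := by
    rw [real_inner_comm]
    exact Submodule.mem_orthogonal_singleton_iff_inner_right.mp y.2
  rw [inner_add_left, h, real_inner_smul_left, real_inner_self_eq_norm_sq, hω]
  simp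

theorem slice_mem_hyperplane {n : ℕ} {ω : Space n} (hω : ‖ω‖ = 1) (p : ℝ) (y : Perp ω) :
    p • ω + (y : Space n) ∈ hyperplane ω p := inner_slice hω p y

theorem lintegral_slice {n : ℕ} {ω : Space n} (hω : ‖ω‖ = 1) {h : Space n → ENNReal}
    (hh : Measurable h) :
    ∫⁻ x, h x = ∫⁻ p : ℝ, ∫⁻ y : Perp ω, h (p • ω + (y : Space n)) := by
  rw [← (measurePreserving_slice hω).lintegral_comp hh, Measure.volume_eq_prod,
    lintegral_prod _ (by fun_prop)]

theorem integral_slice {n : ℕ} {ω : Space n} (hω : ‖ω‖ = 1) {h : Space n → ℝ}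
    (hm : Measurable h) (hh : Integrable h) :
    ∫ x, h x = ∫ p : ℝ, ∫ y : Perp ω, h (p • ω + (y : Space n)) := by
  have hs := measurePreserving_slice hω
  have h1 : ∫ x, h x = ∫ z : ℝ × Perp ω, h (z.1 • ω + (z.2 : Space n)) := by
    rw [← hs.map_eq, integral_map hs.aemeasurable]
    rw [hs.map_eq]
    exact hm.aestronglyMeasurable
  rw [h1, Measure.volume_eq_prod, integral_prod]
  exact hs.integrable_comp_of_integrable hh

/-! ### Dominated convergence from local bounds and a first-moment bound. -/

section Tail

variable {V : Type*} [NormedAddCommGroup V] [MeasurableSpace V] [BorelSpace V]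
  {μ : Measure V}

/-- Markov's inequality: the weight `‖x‖` is at least `R` outside the ball. -/
theorem lintegral_compl_closedBall_le {g : V → ℝ} {C : NNReal}
    (h : ∫⁻ x, ‖x‖ₑ * ‖g x‖ₑ ∂μ ≤ C) {R : ℝ} (hR : 0 < R) :
    ∫⁻ x in (Metric.closedBall 0 R)ᶜ, ‖g x‖ₑ ∂μ ≤ ENNReal.ofReal (C / R) := by
  have hR0 : ENNReal.ofReal R ≠ 0 := by simpa using hR
  have h1 : ENNReal.ofReal R * ∫⁻ x in (Metric.closedBall 0 R)ᶜ, ‖g x‖ₑ ∂μ ≤ C := by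
    rw [← lintegral_const_mul' _ _ ENNReal.ofReal_ne_top]
    refine le_trans ?_ ((setLIntegral_le_lintegral (Metric.closedBall 0 R)ᶜ _).trans h)
    refine setLIntegral_mono' Metric.isClosed_closedBall.measurableSet.compl fun x hx => ?_
    gcongr
    rw [← ofReal_norm]
    refine ENNReal.ofReal_le_ofReal ?_
    simp only [Set.mem_compl_iff, mem_closedBall_zero_iff, not_le] at hx
    exact hx.le
  rw [ENNReal.ofReal_div_of_pos hR, ENNReal.ofReal_coe_nnreal,
    ENNReal.le_div_iff_mul_le (Or.inl hR0) (Or.inl ENNReal.ofReal_ne_top), mul_comm]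
  exact h1

theorem exists_eventually_bound_of_isCompact {X ι : Type*} [TopologicalSpace X] {l : Filter ι}
    {G : ι → X → ℝ} (h : ∀ x, ∃ M, ∀ᶠ z in l ×ˢ 𝓝 x, |G z.1 z.2| ≤ M) {Q : Set X}
    (hQ : IsCompact Q) : ∃ M, ∀ᶠ j in l, ∀ x ∈ Q, |G j x| ≤ M := by
  refine hQ.induction_on (p := fun Q => ∃ M, ∀ᶠ j in l, ∀ x ∈ Q, |G j x| ≤ M) ?_ ?_ ?_ ?_
  · exact ⟨0, by simp⟩
  · intro s t hst ht
    obtain ⟨M, hM⟩ := ht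
    exact ⟨M, hM.mono fun j hj x hx => hj x (hst hx)⟩
  · intro s t hs ht
    obtain ⟨M, hM⟩ := hs
    obtain ⟨M', hM'⟩ := ht
    refine ⟨max M M', ?_⟩
    filter_upwards [hM, hM'] with j hj hj' x hx
    rcases hx with hx | hx
    · exact (hj x hx).trans (le_max_left _ _)
    · exact (hj' x hx).trans (le_max_right _ _)
  · intro x hx
    obtain ⟨M, hM⟩ := h x
    obtain ⟨pa, ha, pb, hb, hab⟩ := eventually_prod_iff.mp hM
    refine ⟨{y | pb y}, mem_nhdsWithin_of_mem_nhds hb, M, ?_⟩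
    filter_upwards [ha] with j hj y hy using hab hj hy

/-- Dominated convergence for locally uniformly bounded functions with uniformly small tails. -/
theorem tendsto_integral_of_tail_bound [ProperSpace V] [IsFiniteMeasureOnCompacts μ] {ι : Type*} {l : Filter ι}
    [l.IsCountablyGenerated] {G : ι → V → ℝ} {g : V → ℝ}
    (hG : ∀ j, AEStronglyMeasurable (G j) μ) (hg : Integrable g μ)
    (hloc : ∀ x, ∃ M, ∀ᶠ z in l ×ˢ 𝓝 x, |G z.1 z.2| ≤ M)
    (hlim : ∀ᵐ x ∂μ, Tendsto (fun j => G j x) l (𝓝 (g x))) {C : NNReal}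
    (hGC : ∀ᶠ j in l, ∫⁻ x, ‖x‖ₑ * ‖G j x‖ₑ ∂μ ≤ C) (hgC : ∫⁻ x, ‖x‖ₑ * ‖g x‖ₑ ∂μ ≤ C) :
    Tendsto (fun j => ∫ x, G j x ∂μ) l (𝓝 (∫ x, g x ∂μ)) := by
  rw [Metric.tendsto_nhds]
  intro ε hε
  -- Large enough for each tail to stay below `ε / 3`; the `+ 1` keeps `R` positive when `C = 0`.
  set R : ℝ := 4 * (C + 1) / ε with hRdef
  have hC0 : (0 : ℝ) ≤ C := C.2
  have hR : 0 < R := by positivity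
  have hCR : (C : ℝ) / R < ε / 3 := by
    rw [hRdef, div_lt_iff₀ (by positivity)]
    field_simp
    linarith
  set B : Set V := Metric.closedBall 0 R with hB
  have hBm : MeasurableSet B := Metric.isClosed_closedBall.measurableSet
  have hBc : IsCompact B := isCompact_closedBall _ _
  have hBf : μ B < ⊤ := hBc.measure_lt_top
  obtain ⟨M, hM⟩ := exists_eventually_bound_of_isCompact hloc hBc
  have tail : ∀ h : V → ℝ, ∫⁻ x, ‖x‖ₑ * ‖h x‖ₑ ∂μ ≤ C → ‖∫ x in Bᶜ, h x ∂μ‖ < ε / 3 := by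
    intro h hh
    refine lt_of_le_of_lt ?_ hCR
    have h1 := (enorm_integral_le_lintegral_enorm (μ := μ.restrict Bᶜ) h).trans
      (lintegral_compl_closedBall_le hh hR)
    rw [← ofReal_norm] at h1
    exact (ENNReal.ofReal_le_ofReal_iff (by positivity)).mp h1
  have hint : Tendsto (fun j => ∫ x in B, G j x ∂μ) l (𝓝 (∫ x in B, g x ∂μ)) := by
    refine tendsto_integral_filter_of_dominated_convergence (fun _ => M)
      (Eventually.of_forall fun j => (hG j).restrict) ?_
      (integrableOn_const hBf.ne) (ae_restrict_of_ae hlim)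
    filter_upwards [hM] with j hj
    filter_upwards [ae_restrict_mem hBm] with x hx using hj x hx
  filter_upwards [Metric.tendsto_nhds.mp hint (ε / 3) (by positivity), hM, hGC] with j h1 h2 h3
  have hi : Integrable (G j) μ := by
    have hB1 : IntegrableOn (G j) B μ :=
      Measure.integrableOn_of_bounded hBf.ne (hG j)
        ((ae_restrict_iff' hBm).mpr (Eventually.of_forall h2))
    have hB2 : IntegrableOn (G j) Bᶜ μ :=
      ⟨(hG j).restrict, lt_of_le_of_lt (lintegral_compl_closedBall_le h3 hR)
        ENNReal.ofReal_lt_top⟩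
    simpa using hB1.union hB2
  rw [← integral_add_compl hBm hi, ← integral_add_compl hBm hg]
  have t1 := tail _ h3
  have t2 := tail _ hgC
  rw [Real.dist_eq, abs_lt] at *
  rw [Real.norm_eq_abs, abs_lt] at t1 t2
  constructor <;> linarith [t1.1, t1.2, t2.1, t2.2, h1.1, h1.2]

end Tail

/-! ### Moments as polynomials, and determinacy by moments. -/

/-- The moments of order `k` of a function are given by a homogeneous polynomial. -/
theorem exists_isHomogeneous_moment {n : ℕ} {α : Type*} [MeasurableSpace α] {μ : Measure α}
    {Y : α → Space n} (hY : Measurable Y) {h : α → ℝ} (hh : AEStronglyMeasurable h μ) (k : ℕ)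
    (hi : Integrable (fun a => ‖Y a‖ ^ k * h a) μ) :
    ∃ P : MvPolynomial (Fin n) ℝ, P.IsHomogeneous k ∧ ∀ η : Space n,
      MvPolynomial.eval (fun i => η i) P = ∫ a, (inner ℝ (Y a) η) ^ k * h a ∂μ := by
  have hint : ∀ σ : Fin k → Fin n, Integrable (fun a => (∏ i, Y a (σ i)) * h a) μ := by
    intro σ
    refine hi.mono (AEStronglyMeasurable.mul ?_ hh) (Eventually.of_forall fun a => ?_)
    · refine Measurable.aestronglyMeasurable ?_
      refine Finset.measurable_prod _ fun i _ => ?_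
      fun_prop
    · rw [norm_mul, norm_mul, norm_pow, norm_norm]
      gcongr
      rw [norm_prod]
      calc ∏ i, ‖Y a (σ i)‖ ≤ ∏ _i : Fin k, ‖Y a‖ :=
            Finset.prod_le_prod (fun _ _ => norm_nonneg _) fun i _ => PiLp.norm_apply_le _ _
        _ = ‖Y a‖ ^ k := by simp
  refine ⟨∑ σ : Fin k → Fin n, MvPolynomial.C (∫ a, (∏ i, Y a (σ i)) * h a ∂μ) *
    ∏ i, MvPolynomial.X (σ i), ?_, fun η => ?_⟩
  · refine MvPolynomial.IsHomogeneous.sum _ _ _ fun σ _ => ?_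
    have h1 := (MvPolynomial.isHomogeneous_C (Fin n) (∫ a, (∏ i, Y a (σ i)) * h a ∂μ)).mul
      (MvPolynomial.IsHomogeneous.prod Finset.univ (fun i => MvPolynomial.X (σ i) (R := ℝ))
        (fun _ => 1) fun i _ => MvPolynomial.isHomogeneous_X _ _)
    simpa using h1
  · have h2 : ∀ a, (inner ℝ (Y a) η) ^ k * h a =
        ∑ σ : Fin k → Fin n, (∏ i, η (σ i)) * ((∏ i, Y a (σ i)) * h a) := by
      intro a
      rw [PiLp.inner_apply, Finset.sum_pow', Fintype.piFinset_univ, Finset.sum_mul]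
      refine Finset.sum_congr rfl fun σ _ => ?_
      simp only [RCLike.inner_apply, conj_trivial, Finset.prod_mul_distrib]
      ring
    simp_rw [h2]
    rw [integral_finsetSum _ fun σ _ => (hint σ).const_mul _]
    simp only [map_sum, map_mul, map_prod, MvPolynomial.eval_C, MvPolynomial.eval_X]
    refine Finset.sum_congr rfl fun σ _ => ?_
    rw [integral_const_mul, mul_comm]

open ProbabilityTheory in
/-- Two finite measures with small exponential moments and the same moments in every direction
are equal. -/
theorem measure_ext_of_moments {V : Type*} [NormedAddCommGroup V] [InnerProductSpace ℝ V]
    [FiniteDimensional ℝ V] [MeasurableSpace V] [BorelSpace V] {ν ν' : Measure V}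
    [IsFiniteMeasure ν] [IsFiniteMeasure ν'] {μ : ℝ} (hμ : 0 < μ)
    (hν : Integrable (fun y => Real.exp (μ * ‖y‖)) ν)
    (hν' : Integrable (fun y => Real.exp (μ * ‖y‖)) ν')
    (hmom : ∀ (k : ℕ) (η : V), ∫ y, (inner ℝ y η) ^ k ∂ν = ∫ y, (inner ℝ y η) ^ k ∂ν') :
    ν = ν' := by
  refine Measure.ext_of_charFun (funext fun t => ?_)
  set X : V → ℝ := fun y => inner ℝ y t with hX
  -- Ensures `r * ‖t‖ ≤ μ`, so `exp (s * ⟨y, t⟩)` is dominated for `|s| < r`; the `+ 1` covers `t =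
  -- 0`.
  set r : ℝ := μ / (‖t‖ + 1) with hr
  have hr0 : 0 < r := by positivity
  have hsub : ∀ κ : Measure V, Integrable (fun y => Real.exp (μ * ‖y‖)) κ →
      Set.Ioo (-r) r ⊆ interior (integrableExpSet X κ) := by
    intro κ hκ
    refine interior_maximal (fun s hs => ?_) isOpen_Ioo
    refine hκ.mono (by fun_prop) (Eventually.of_forall fun y => ?_)
    rw [Real.norm_eq_abs, Real.norm_eq_abs, Real.abs_exp, Real.abs_exp]
    refine Real.exp_le_exp.mpr ?_
    have h1 : |X y| ≤ ‖y‖ * ‖t‖ := abs_real_inner_le_norm y t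
    have h2 : |s| ≤ r := (abs_lt.mpr hs).le
    have h3 : r * ‖t‖ ≤ μ := by
      rw [hr, div_mul_eq_mul_div, div_le_iff₀ (by positivity)]
      nlinarith [norm_nonneg t]
    calc s * X y ≤ |s * X y| := le_abs_self _
      _ = |s| * |X y| := abs_mul _ _
      _ ≤ r * (‖y‖ * ‖t‖) := by gcongr
      _ = r * ‖t‖ * ‖y‖ := by ring
      _ ≤ μ * ‖y‖ := by gcongr
  set S : Set ℂ := {z | z.re ∈ Set.Ioo (-r) r} with hS
  have hSc : Convex ℝ S := (convex_Ioo (-r) r).linear_preimage Complex.reLm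
  have h0S : (0 : ℂ) ∈ S := by simp [hS, hr0]
  have han : ∀ κ : Measure V, Integrable (fun y => Real.exp (μ * ‖y‖)) κ →
      AnalyticOnNhd ℂ (complexMGF X κ) S := fun κ hκ z hz =>
    analyticAt_complexMGF (hsub κ hκ hz)
  have hder : ∀ κ : Measure V, Integrable (fun y => Real.exp (μ * ‖y‖)) κ → ∀ k : ℕ,
      iteratedDeriv k (complexMGF X κ) 0 = ((∫ y, (inner ℝ y t) ^ k ∂κ : ℝ) : ℂ) := by
    intro κ hκ k
    rw [iteratedDeriv_complexMGF (hsub κ hκ h0S), ← integral_complex_ofReal]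
    simp [hX]
  -- Both functions have the moments as derivatives at `0`, hence the same Taylor series. The
  -- identity theorem then spreads equality over the strip, and the value at `Complex.I` is the
  -- characteristic function at `t`.
  have hloc : complexMGF X ν =ᶠ[𝓝 0] complexMGF X ν' := by
    have e1 := (han ν hν 0 h0S).hasFPowerSeriesAt.eventually_hasSum
    have e2 := (han ν' hν' 0 h0S).hasFPowerSeriesAt.eventually_hasSum
    simp only [hder ν hν, hder ν' hν', hmom, zero_add] at e1 e2
    filter_upwards [e1, e2] with z h1 h2 using h1.unique h2
  have heq := (han ν hν).eqOn_of_preconnected_of_eventuallyEq (han ν' hν')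
    hSc.isPreconnected h0S hloc
  have hI : Complex.I ∈ S := by simp [hS, hr0]
  have h := heq hI
  simpa [complexMGF, charFun_apply, hX, mul_comm] using h

/-- A continuous function with exponential decay all of whose moments vanish is zero. -/
theorem eq_zero_of_moments_eq_zero {V : Type*} [NormedAddCommGroup V] [InnerProductSpace ℝ V]
    [FiniteDimensional ℝ V] [MeasurableSpace V] [BorelSpace V] {h : V → ℝ} (hc : Continuous h)
    {μ : ℝ} (hμ : 0 < μ) (hexp : Integrable (fun y => h y * Real.exp (μ * ‖y‖)))
    (hmom : ∀ (k : ℕ) (η : V), ∫ y, (inner ℝ y η) ^ k * h y = 0) : h = 0 := by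
  have hi : Integrable h := by
    refine hexp.mono hc.aestronglyMeasurable (Eventually.of_forall fun y => ?_)
    rw [norm_mul, Real.norm_eq_abs (Real.exp _), Real.abs_exp]
    exact le_mul_of_one_le_right (norm_nonneg _) (Real.one_le_exp (by positivity))
  have hpow : ∀ k : ℕ, ∃ c : ℝ, ∀ s : ℝ, 0 ≤ s → s ^ k ≤ c * Real.exp (μ * s) := by
    intro k
    refine ⟨k.factorial / μ ^ k, fun s hs => ?_⟩
    have h1 := Real.pow_div_factorial_le_exp (μ * s) (by positivity) k
    rw [div_mul_eq_mul_div, le_div_iff₀ (by positivity)]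
    rw [div_le_iff₀ (by positivity), mul_pow] at h1
    linarith
  have hmi : ∀ (k : ℕ) (η : V), Integrable (fun y => (inner ℝ y η) ^ k * h y) := by
    intro k η
    obtain ⟨c, hcc⟩ := hpow k
    refine (hexp.const_mul (‖η‖ ^ k * c)).mono (by fun_prop) (Eventually.of_forall fun y => ?_)
    have hc0 : 0 ≤ c := by
      by_contra hneg
      have := hcc 0 le_rfl
      have h2 : (0 : ℝ) ≤ 0 ^ k := by positivity
      simp at this
      linarith
    have h1 : |inner ℝ y η| ≤ ‖y‖ * ‖η‖ := abs_real_inner_le_norm y η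
    simp only [norm_mul, norm_pow, Real.norm_eq_abs, Real.abs_exp, abs_norm, abs_of_nonneg hc0]
    calc |inner ℝ y η| ^ k * |h y| ≤ (‖y‖ * ‖η‖) ^ k * |h y| := by gcongr
      _ = ‖η‖ ^ k * |h y| * ‖y‖ ^ k := by ring
      _ ≤ ‖η‖ ^ k * |h y| * (c * Real.exp (μ * ‖y‖)) := by
        gcongr
        exact hcc _ (norm_nonneg _)
      _ = ‖η‖ ^ k * c * (|h y| * Real.exp (μ * ‖y‖)) := by ring
  -- The determinacy result needs positive measures, so it is applied to those with densities `h⁺`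
  -- and `h⁻`, whose moments agree. Then `h⁺ = h⁻` almost everywhere, which forces `h = 0`.
  have hcn : Continuous fun y => Real.toNNReal (h y) := by fun_prop
  have hcn' : Continuous fun y => Real.toNNReal (-h y) := by fun_prop
  have hfin : ∀ g : V → ℝ, Integrable g →
      ∫⁻ y, (Real.toNNReal (g y) : ENNReal) ≠ ⊤ := fun g hg => hg.lintegral_lt_top.ne
  have : IsFiniteMeasure (volume.withDensity fun y => (Real.toNNReal (h y) : ENNReal)) :=
    isFiniteMeasure_withDensity (hfin _ hi)
  have : IsFiniteMeasure (volume.withDensity fun y => (Real.toNNReal (-h y) : ENNReal)) :=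
    isFiniteMeasure_withDensity (hfin _ hi.neg)
  have hint : ∀ g : V → ℝ, Continuous g → (∀ y, |g y| ≤ |h y|) → ∀ u : V → ℝ, Continuous u →
      Integrable (fun y => u y * h y) →
      Integrable u (volume.withDensity fun y => (Real.toNNReal (g y) : ENNReal)) ∧
      Integrable (fun y => Real.toNNReal (g y) • u y) := by
    intro g hg hgh u hu hui
    rw [integrable_withDensity_iff_integrable_smul (by fun_prop), and_self]
    refine hui.mono ?_ (Eventually.of_forall fun y => ?_)
    · refine Continuous.aestronglyMeasurable ?_
      simp only [NNReal.smul_def]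
      fun_prop
    · rw [NNReal.smul_def, smul_eq_mul, norm_mul, norm_mul, mul_comm]
      gcongr
      rw [Real.norm_eq_abs, Real.norm_eq_abs, Real.coe_toNNReal', abs_of_nonneg (le_max_right _ _)]
      exact max_le ((le_abs_self _).trans (hgh y)) (abs_nonneg _)
  have key : (volume.withDensity fun y => (Real.toNNReal (h y) : ENNReal)) =
      volume.withDensity fun y => (Real.toNNReal (-h y) : ENNReal) := by
    have hexp' : Integrable (fun y => Real.exp (μ * ‖y‖) * h y) := by
      simpa only [mul_comm] using hexp
    refine measure_ext_of_moments hμ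
      (hint h hc (fun _ => le_rfl) _ (by fun_prop) hexp').1
      (hint (fun y => -h y) hc.neg (fun y => (abs_neg _).le) _ (by fun_prop) hexp').1
      fun k η => ?_
    rw [integral_withDensity_eq_integral_smul (by fun_prop),
      integral_withDensity_eq_integral_smul (by fun_prop), ← sub_eq_zero, ← integral_sub
      (hint h hc (fun _ => le_rfl) _ (by fun_prop) (hmi k η)).2
      (hint (fun y => -h y) hc.neg (fun y => (abs_neg _).le) _ (by fun_prop) (hmi k η)).2,
      ← hmom k η]
    refine integral_congr_ae (Eventually.of_forall fun y => ?_)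
    simp only [NNReal.smul_def, Real.coe_toNNReal', smul_eq_mul]
    rw [← sub_mul, mul_comm]
    congr 1
    rcases le_total 0 (h y) with hy | hy
    · rw [max_eq_left hy, max_eq_right (by linarith), sub_zero]
    · rw [max_eq_right hy, max_eq_left (by linarith)]
      ring
  have hae : h =ᵐ[volume] 0 := by
    have h1 := (withDensity_eq_iff (by fun_prop) (by fun_prop) (hfin _ hi)).mp key
    filter_upwards [h1] with y hy
    have hy' := congrArg NNReal.toReal (ENNReal.coe_injective hy)
    rw [Real.coe_toNNReal', Real.coe_toNNReal'] at hy'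
    rcases le_total 0 (h y) with h2 | h2
    · rw [max_eq_left h2, max_eq_right (by linarith)] at hy'
      exact hy'
    · rw [max_eq_right h2, max_eq_left (by linarith)] at hy'
      simp only [Pi.zero_apply]
      linarith
  exact hc.ae_eq_iff_eq volume continuous_zero |>.mp hae

/-! ### Functions with zero weak derivative. -/

/-- A form of the du Bois-Reymond lemma: a continuous function orthogonal to the derivatives of all
continuously differentiable functions supported in `[a, b]` takes equal values at `a` and `b`. -/
theorem eq_of_integral_deriv_mul_eq_zero {a b : ℝ} (hab : a < b) {N : ℝ → ℝ}
    (hN : ContinuousOn N (Set.Icc a b))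
    (h : ∀ φ ψ : ℝ → ℝ, (∀ t, HasDerivAt φ (ψ t) t) → Continuous ψ →
      (∀ t ∉ Set.Icc a b, φ t = 0) → (∀ t ∉ Set.Icc a b, ψ t = 0) → ∫ t, ψ t * N t = 0) :
    N a = N b := by
  set N' : ℝ → ℝ := Set.IccExtend hab.le ((Set.Icc a b).domRestrict N) with hN'def
  have hN' : Continuous N' := (continuousOn_iff_continuous_domRestrict.mp hN).Icc_extend'
  have hNN : ∀ t ∈ Set.Icc a b, N' t = N t := fun t ht => by
    rw [hN'def, Set.IccExtend_of_mem hab.le _ ht]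
    rfl
  set w : ℝ → ℝ := fun t => max 0 ((t - a) * (b - t)) with hw
  have hwc : Continuous w := by fun_prop
  have hw0 : ∀ t, 0 ≤ w t := fun t => le_max_left _ _
  have hwpos : ∀ t ∈ Set.Ioo a b, 0 < w t := fun t ht =>
    lt_max_of_lt_right (mul_pos (sub_pos.mpr ht.1) (sub_pos.mpr ht.2))
  have hwl : ∀ t ≤ a, w t = 0 := fun t ht =>
    max_eq_left (mul_nonpos_of_nonpos_of_nonneg (by linarith) (by linarith))
  have hwr : ∀ t, b ≤ t → w t = 0 := fun t ht =>
    max_eq_left (mul_nonpos_of_nonneg_of_nonpos (by linarith) (by linarith))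
  have hmid : (a + b) / 2 ∈ Set.Ioo a b := ⟨by linarith, by linarith⟩
  have hW : 0 < ∫ t in a..b, w t :=
    intervalIntegral.integral_pos hab hwc.continuousOn (fun t _ => hw0 t)
      ⟨_, Set.Ioo_subset_Icc_self hmid, hwpos _ hmid⟩
  -- The `w`-weighted mean of `N'`: with it `ψ` has integral zero, so its primitive from `a`
  -- vanishes outside `[a, b]` and is an admissible test function. Testing gives `∫ w (N' - c)² =
  -- 0`.
  set c : ℝ := (∫ t in a..b, w t * N' t) / ∫ t in a..b, w t with hc
  set ψ : ℝ → ℝ := fun t => w t * (N' t - c) with hψ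
  have hψc : Continuous ψ := by fun_prop
  have hψi : ∀ u v, IntervalIntegrable ψ volume u v := fun u v => hψc.intervalIntegrable u v
  have hψl : ∀ t ≤ a, ψ t = 0 := fun t ht => by simp [hψ, hwl t ht]
  have hψr : ∀ t, b ≤ t → ψ t = 0 := fun t ht => by simp [hψ, hwr t ht]
  have hψ0 : ∫ t in a..b, ψ t = 0 := by
    simp only [hψ, mul_sub]
    rw [intervalIntegral.integral_sub ((by fun_prop : Continuous fun t => w t * N' t).intervalIntegrable _ _)
      ((by fun_prop : Continuous fun t => w t * c).intervalIntegrable _ _), intervalIntegral.integral_mul_const, hc,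
      mul_div_cancel₀ _ hW.ne', sub_self]
  have key := h (fun u => ∫ t in a..u, ψ t) ψ (fun t =>
    intervalIntegral.integral_hasDerivAt_right (hψi _ _)
      (hψc.stronglyMeasurableAtFilter _ _) hψc.continuousAt) hψc ?_ ?_
  rotate_left
  · intro t ht
    rcases lt_or_ge t a with h1 | h1
    · refine intervalIntegral.integral_zero_ae (Eventually.of_forall fun s hs => ?_)
      rw [Set.uIoc_of_ge h1.le] at hs
      exact hψl s hs.2
    · have h2 : b < t := by
        by_contra h3
        exact ht ⟨h1, not_lt.mp h3⟩
      show ∫ t in a..t, ψ t = 0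
      rw [← intervalIntegral.integral_add_adjacent_intervals (hψi a b) (hψi b t), hψ0, zero_add]
      refine intervalIntegral.integral_zero_ae (Eventually.of_forall fun s hs => ?_)
      rw [Set.uIoc_of_le h2.le] at hs
      exact hψr s hs.1.le
  · intro t ht
    rcases lt_or_ge t a with h1 | h1
    · exact hψl t h1.le
    · exact hψr t (not_lt.mp fun h3 => ht ⟨h1, h3.le⟩)
  have key2 : ∫ t in a..b, ψ t * N' t = 0 := by
    rw [intervalIntegral.integral_of_le hab.le, ← integral_Icc_eq_integral_Ioc]
    refine (setIntegral_congr_fun (g := fun t => ψ t * N t) measurableSet_Icc fun t ht =>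
      congrArg (ψ t * ·) (hNN t ht)).trans ?_
    rw [setIntegral_eq_integral_of_forall_compl_eq_zero, key]
    · intro t ht
      rcases lt_or_ge t a with h1 | h1
      · rw [hψl t h1.le, zero_mul]
      · rw [hψr t (not_lt.mp fun h3 => ht ⟨h1, h3.le⟩), zero_mul]
  have key3 : ∫ t in a..b, w t * (N' t - c) ^ 2 = 0 := by
    have e : ∀ t, w t * (N' t - c) ^ 2 = ψ t * N' t - ψ t * c := fun t => by
      simp only [hψ]; ring
    simp_rw [e]
    rw [intervalIntegral.integral_sub ((by fun_prop : Continuous fun t => ψ t * N' t).intervalIntegrable _ _)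
      ((by fun_prop : Continuous fun t => ψ t * c).intervalIntegrable _ _), intervalIntegral.integral_mul_const,
      key2, hψ0]
    simp
  have hconst : Set.EqOn N' (fun _ => c) (Set.Ioo a b) := by
    intro t ht
    by_contra hne
    have h1 : 0 < ∫ t in a..b, w t * (N' t - c) ^ 2 :=
      intervalIntegral.integral_pos hab (by fun_prop)
        (fun t _ => mul_nonneg (hw0 t) (sq_nonneg _))
        ⟨t, Set.Ioo_subset_Icc_self ht,
          mul_pos (hwpos t ht) (sq_pos_of_ne_zero (sub_ne_zero.mpr hne))⟩
    exact h1.ne' key3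
  have hcl := hconst.closure hN' continuous_const
  rw [closure_Ioo hab.ne] at hcl
  rw [← hNN a (Set.left_mem_Icc.mpr hab.le), ← hNN b (Set.right_mem_Icc.mpr hab.le),
    hcl (Set.left_mem_Icc.mpr hab.le), hcl (Set.right_mem_Icc.mpr hab.le)]

/-! ### Moment bounds on hyperplanes and slabs. -/

variable {n : ℕ} {h : Space n → ℝ} {ω : Space n}

theorem continuous_comp_slice {p : ℝ} (hω : ‖ω‖ = 1)
    (hc : ∀ x ∈ hyperplane ω p, ContinuousAt h x) :
    Continuous fun y : Perp ω => h (p • ω + (y : Space n)) :=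
  continuous_iff_continuousAt.mpr fun y =>
    ContinuousAt.comp (f := fun y : Perp ω => p • ω + (y : Space n))
      (hc _ (slice_mem_hyperplane hω p y)) (continuous_slice ω p).continuousAt

theorem abs_inner_pow_mul_le {V : Type*} [NormedAddCommGroup V] [InnerProductSpace ℝ V]
    (y η : V) (k : ℕ) (r : ℝ) : |inner ℝ y η ^ k * r| ≤ ‖η‖ ^ k * |‖y‖ ^ k * r| := by
  rw [abs_mul, abs_mul, abs_pow, abs_pow, abs_norm, ← mul_assoc, ← mul_pow, mul_comm ‖η‖]
  gcongr
  exact abs_real_inner_le_norm y η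

theorem enorm_inner_pow_mul_le {V : Type*} [NormedAddCommGroup V] [InnerProductSpace ℝ V]
    (y η : V) (k : ℕ) (r : ℝ) : ‖inner ℝ y η ^ k * r‖ₑ ≤ ‖η‖ₑ ^ k * ‖‖y‖ ^ k * r‖ₑ := by
  have h1 := ENNReal.ofReal_le_ofReal (abs_inner_pow_mul_le y η k r)
  rw [ENNReal.ofReal_mul (by positivity), ENNReal.ofReal_pow (norm_nonneg _),
    ← Real.norm_eq_abs, ← Real.norm_eq_abs, ofReal_norm, ofReal_norm, ofReal_norm] at h1
  exact h1

theorem integrable_norm_pow_mul_slice {p : ℝ} (hm : Measurable h) {k : ℕ} {C : NNReal}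
    (hC : ∫⁻ y : Perp ω, ‖‖y‖ ^ k * h (p • ω + (y : Space n))‖ₑ ≤ C) :
    Integrable fun y : Perp ω => ‖y‖ ^ k * h (p • ω + (y : Space n)) :=
  ⟨(by fun_prop : Measurable _).aestronglyMeasurable, hC.trans_lt ENNReal.coe_lt_top⟩

theorem integrable_inner_pow_mul_slice {p : ℝ} (hm : Measurable h) {k : ℕ} {C : NNReal}
    (hC : ∫⁻ y : Perp ω, ‖‖y‖ ^ k * h (p • ω + (y : Space n))‖ₑ ≤ C) (η : Space n) :
    Integrable fun y : Perp ω => inner ℝ (y : Space n) η ^ k * h (p • ω + (y : Space n)) := by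
  refine ((integrable_norm_pow_mul_slice hm hC).norm.const_mul (‖η‖ ^ k)).mono'
    (by fun_prop : Measurable _).aestronglyMeasurable (Eventually.of_forall fun y => ?_)
  exact abs_inner_pow_mul_le (y : Space n) η k _

/-- Moments over parallel hyperplanes depend continuously on the offset. -/
theorem continuousOn_moment {J : Set ℝ} (hω : ‖ω‖ = 1) (hm : Measurable h)
    (hc : ∀ p ∈ J, ∀ x ∈ hyperplane ω p, ContinuousAt h x)
    (hb : ∀ p ∈ J, ∀ k : ℕ, ∃ ε > 0, ∃ C : NNReal, ∀ p' ∈ J, |p' - p| < ε →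
      ∫⁻ y : Perp ω, ‖‖y‖ ^ k * h (p' • ω + (y : Space n))‖ₑ ≤ C) (k : ℕ) (η : Space n) :
    ContinuousOn (fun p => ∫ y : Perp ω, inner ℝ (y : Space n) η ^ k *
      h (p • ω + (y : Space n))) J := by
  intro p hp
  obtain ⟨ε, hε, C, hC⟩ := hb p hp (k + 1)
  obtain ⟨ε', hε', C', hC'⟩ := hb p hp k
  have hcont : ∀ y : Perp ω, ContinuousAt (fun z : ℝ × Perp ω =>
      inner ℝ (z.2 : Space n) η ^ k * h (z.1 • ω + (z.2 : Space n))) (p, y) := by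
    intro y
    refine ContinuousAt.mul (by fun_prop) ?_
    exact ContinuousAt.comp (f := fun z : ℝ × Perp ω => z.1 • ω + (z.2 : Space n))
      (hc p hp _ (slice_mem_hyperplane hω p y)) (by fun_prop)
  have htail : ∀ q ∈ J, |q - p| < ε → ∫⁻ y : Perp ω, ‖y‖ₑ * ‖inner ℝ (y : Space n) η ^ k *
      h (q • ω + (y : Space n))‖ₑ ≤ ((‖η‖₊ ^ k * C : NNReal) : ENNReal) := by
    intro q hq hqp
    rw [ENNReal.coe_mul]
    refine le_trans ?_ (mul_le_mul_right (hC q hq hqp) _)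
    rw [← lintegral_const_mul' _ _ ENNReal.coe_ne_top]
    refine lintegral_mono fun y => ?_
    calc ‖y‖ₑ * ‖inner ℝ (y : Space n) η ^ k * h (q • ω + (y : Space n))‖ₑ
        ≤ ‖y‖ₑ * (‖η‖ₑ ^ k * ‖‖y‖ ^ k * h (q • ω + (y : Space n))‖ₑ) := by
          gcongr
          exact enorm_inner_pow_mul_le (y : Space n) η k _
      _ = _ := by
          rw [pow_succ', enorm_mul, enorm_mul, enorm_mul, enorm_norm, ENNReal.coe_pow,
            ← enorm_eq_nnnorm]
          ring
  refine tendsto_integral_of_tail_bound (C := ‖η‖₊ ^ k * C) (fun q => ?_) ?_ (fun y => ?_)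
    (Eventually.of_forall fun y => ?_) ?_ ?_
  · exact (by fun_prop : Measurable _).aestronglyMeasurable
  · exact integrable_inner_pow_mul_slice hm (hC' p hp (by simpa using hε')) η
  · refine ⟨|inner ℝ (y : Space n) η ^ k * h (p • ω + (y : Space n))| + 1, ?_⟩
    have h1 := (hcont y).abs.tendsto.eventually (eventually_le_nhds (lt_add_one _))
    rw [nhds_prod_eq] at h1
    exact h1.filter_mono (prod_mono nhdsWithin_le_nhds le_rfl)
  · exact ((hcont y).comp (f := fun q : ℝ => (q, y)) (by fun_prop)).tendsto.mono_left
      nhdsWithin_le_nhds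
  · have h1 : ∀ᶠ q in 𝓝[J] p, |q - p| < ε :=
      mem_nhdsWithin_of_mem_nhds (Metric.ball_mem_nhds p hε)
    filter_upwards [h1, self_mem_nhdsWithin] with q hq hqJ using htail q hqJ hq
  · exact htail p hp (by simpa using hε)

/-- Locally uniform moment bounds are uniform on compact intervals. -/
theorem exists_uniform_bound {W : Set (Space n)} {J : Set ℝ} {k : ℕ}
    (hb : ∀ p ∈ J, ∃ ε > 0, ∃ C : NNReal, ∀ p' ∈ J, |p' - p| < ε → ∀ ω ∈ W,
      ∫⁻ y : Perp ω, ‖‖y‖ ^ k * h (p' • ω + (y : Space n))‖ₑ ≤ C) {Q : Set ℝ} (hQ : IsCompact Q)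
    (hQJ : Q ⊆ J) : ∃ C : NNReal, ∀ p ∈ Q, ∀ ω ∈ W,
      ∫⁻ y : Perp ω, ‖‖y‖ ^ k * h (p • ω + (y : Space n))‖ₑ ≤ C := by
  have h1 : ∃ C : NNReal, ∀ p ∈ Q, p ∈ J → ∀ ω ∈ W,
      ∫⁻ y : Perp ω, ‖‖y‖ ^ k * h (p • ω + (y : Space n))‖ₑ ≤ C := by
    refine hQ.induction_on (p := fun Q => ∃ C : NNReal, ∀ p ∈ Q, p ∈ J → ∀ ω ∈ W,
      ∫⁻ y : Perp ω, ‖‖y‖ ^ k * h (p • ω + (y : Space n))‖ₑ ≤ C) ?_ ?_ ?_ ?_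
    · exact ⟨0, by simp⟩
    · rintro s t hst ⟨C, hC⟩
      exact ⟨C, fun p hp => hC p (hst hp)⟩
    · rintro s t ⟨C, hC⟩ ⟨C', hC'⟩
      refine ⟨max C C', ?_⟩
      rintro p (hp | hp) hpJ ω hω
      · exact (hC p hp hpJ ω hω).trans (by exact_mod_cast le_max_left C C')
      · exact (hC' p hp hpJ ω hω).trans (by exact_mod_cast le_max_right C C')
    · intro p hp
      obtain ⟨ε, hε, C, hC⟩ := hb p (hQJ hp)
      exact ⟨Metric.ball p ε, mem_nhdsWithin_of_mem_nhds (Metric.ball_mem_nhds p hε), C,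
        fun p' hp' hJ => hC p' hJ hp'⟩
  obtain ⟨C, hC⟩ := h1
  exact ⟨C, fun p hp => hC p hp (hQJ hp)⟩

/-- Moments over hyperplanes, uniformly bounded for offsets in `[a, b]`, give bounds for the
moments over slabs. -/
theorem exists_slab_bound {W : Set (Space n)} (hW : ∀ ω ∈ W, ‖ω‖ = 1) (hm : Measurable h)
    {a b : ℝ} (hb : ∀ k : ℕ, ∃ C : NNReal, ∀ p ∈ Set.Icc a b, ∀ ω ∈ W,
      ∫⁻ y : Perp ω, ‖‖y‖ ^ k * h (p • ω + (y : Space n))‖ₑ ≤ C) (k : ℕ) :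
    ∃ C : NNReal, ∀ ω ∈ W, ∫⁻ x, {x : Space n | inner ℝ x ω ∈ Set.Icc a b}.indicator
      (fun x => ‖‖x‖ ^ k * h x‖ₑ) x ≤ C := by
  obtain ⟨C₀, hC₀⟩ := hb 0
  obtain ⟨C₁, hC₁⟩ := hb k
  set T : ℝ := max |a| |b| with hT
  have hT0 : 0 ≤ T := le_max_of_le_left (abs_nonneg a)
  -- From `‖p • ω + y‖ ≤ T + ‖y‖` and `(T + s) ^ k ≤ 2 ^ (k - 1) * (T ^ k + s ^ k)`, which also
  -- holds for `k = 0` with truncated subtraction.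
  set D : NNReal := Real.toNNReal (2 ^ (k - 1)) * (Real.toNNReal T ^ k * C₀ + C₁) with hD
  refine ⟨D * Real.toNNReal (b - a), fun ω hω => ?_⟩
  have hslab : MeasurableSet {x : Space n | inner ℝ x ω ∈ Set.Icc a b} :=
    measurableSet_Icc.preimage (by fun_prop : Measurable fun x : Space n => inner ℝ x ω)
  rw [lintegral_slice (hW ω hω) ((by fun_prop : Measurable _).indicator hslab)]
  have hle : ∀ p ∈ Set.Icc a b, ∫⁻ y : Perp ω,
      ‖‖p • ω + (y : Space n)‖ ^ k * h (p • ω + (y : Space n))‖ₑ ≤ D := by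
    intro p hp
    have hpt : ∀ y : Perp ω, ‖‖p • ω + (y : Space n)‖ ^ k * h (p • ω + (y : Space n))‖ₑ ≤
        (Real.toNNReal (2 ^ (k - 1)) : ENNReal) *
          ((Real.toNNReal T ^ k : NNReal) * ‖‖y‖ ^ 0 * h (p • ω + (y : Space n))‖ₑ +
            ‖‖y‖ ^ k * h (p • ω + (y : Space n))‖ₑ) := by
      intro y
      have hpT : |p| ≤ T := abs_le_max_abs_abs hp.1 hp.2
      have h1 : ‖p • ω + (y : Space n)‖ ≤ T + ‖y‖ := by
        refine (norm_add_le _ _).trans ?_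
        rw [norm_smul, hW ω hω, mul_one]
        exact add_le_add hpT le_rfl
      have h2 : ‖p • ω + (y : Space n)‖ ^ k ≤ 2 ^ (k - 1) * (T ^ k + ‖y‖ ^ k) :=
        (pow_le_pow_left₀ (norm_nonneg _) h1 k).trans (add_pow_le hT0 (norm_nonneg _) k)
      have h3 : |‖p • ω + (y : Space n)‖ ^ k * h (p • ω + (y : Space n))| ≤
          2 ^ (k - 1) * (T ^ k * |‖y‖ ^ 0 * h (p • ω + (y : Space n))| +
            |‖y‖ ^ k * h (p • ω + (y : Space n))|) := by
        rw [abs_mul, abs_mul, abs_mul, abs_pow, abs_pow, abs_pow, abs_norm, abs_norm]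
        calc _ ≤ 2 ^ (k - 1) * (T ^ k + ‖y‖ ^ k) * |h (p • ω + (y : Space n))| := by gcongr
          _ = _ := by ring
      have h4 := ENNReal.ofReal_le_ofReal h3
      rw [ENNReal.ofReal_mul (by positivity), ENNReal.ofReal_add (by positivity) (by positivity),
        ENNReal.ofReal_mul (by positivity), ← Real.norm_eq_abs, ← Real.norm_eq_abs,
        ← Real.norm_eq_abs, ofReal_norm, ofReal_norm, ofReal_norm, ENNReal.ofReal_pow hT0] at h4
      simpa [ENNReal.ofReal] using h4
    refine (lintegral_mono hpt).trans ?_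
    rw [lintegral_const_mul' _ _ ENNReal.coe_ne_top, lintegral_add_left (by fun_prop),
      lintegral_const_mul' _ _ ENNReal.coe_ne_top, hD, ENNReal.coe_mul, ENNReal.coe_add,
      ENNReal.coe_mul]
    gcongr
    · exact hC₀ p hp ω hω
    · exact hC₁ p hp ω hω
  calc _ ≤ ∫⁻ p : ℝ, (Set.Icc a b).indicator (fun _ => (D : ENNReal)) p := by
        refine lintegral_mono fun p => ?_
        by_cases hp : p ∈ Set.Icc a b
        · rw [Set.indicator_of_mem hp]
          refine le_trans (lintegral_mono fun y => ?_) (hle p hp)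
          exact Set.indicator_le_self _ _ _
        · rw [Set.indicator_of_notMem hp]
          refine le_of_eq ?_
          rw [← lintegral_zero (μ := (volume : Measure (Perp ω)))]
          refine lintegral_congr fun y => Set.indicator_of_notMem ?_ _
          simpa only [Set.mem_ofPred_eq, inner_slice (hW ω hω)] using hp
    _ = _ := by
        rw [lintegral_indicator_const measurableSet_Icc, Real.volume_Icc, ENNReal.coe_mul]
        rfl

theorem integrable_slab {a b L : ℝ} {ψ : ℝ → ℝ} (hψm : Measurable ψ) (hψL : ∀ t, |ψ t| ≤ L)
    (hψ0 : ∀ t ∉ Set.Icc a b, ψ t = 0) (hm : Measurable h) {k : ℕ} {C : NNReal}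
    (hC : ∫⁻ x, {x : Space n | inner ℝ x ω ∈ Set.Icc a b}.indicator
      (fun x => ‖‖x‖ ^ k * h x‖ₑ) x ≤ C) (ι : Space n) :
    Integrable fun x => ψ (inner ℝ x ω) * (inner ℝ x ι ^ k * h x) := by
  refine ⟨(by fun_prop : Measurable _).aestronglyMeasurable, ?_⟩
  have hle : ∀ x : Space n, ‖ψ (inner ℝ x ω) * (inner ℝ x ι ^ k * h x)‖ₑ ≤
      (ENNReal.ofReal L * ‖ι‖ₑ ^ k) * {x : Space n | inner ℝ x ω ∈ Set.Icc a b}.indicator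
        (fun x => ‖‖x‖ ^ k * h x‖ₑ) x := by
    intro x
    by_cases hx : inner ℝ x ω ∈ Set.Icc a b
    · rw [Set.indicator_of_mem (by exact hx), enorm_mul, mul_assoc]
      refine mul_le_mul' ?_ (enorm_inner_pow_mul_le x ι k _)
      rw [← ofReal_norm]
      exact ENNReal.ofReal_le_ofReal (hψL _)
    · simp [hψ0 _ hx]
  refine (lintegral_mono hle).trans_lt ?_
  rw [lintegral_const_mul' _ _ (by finiteness)]
  exact ENNReal.mul_lt_top (by finiteness) (hC.trans_lt ENNReal.coe_lt_top)

theorem integral_slab {ψ : ℝ → ℝ} (hψm : Measurable ψ) (hm : Measurable h) (hω : ‖ω‖ = 1) {k : ℕ}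
    {ι : Space n} (hi : Integrable fun x => ψ (inner ℝ x ω) * (inner ℝ x ι ^ k * h x)) :
    ∫ x, ψ (inner ℝ x ω) * (inner ℝ x ι ^ k * h x) =
      ∫ p, ψ p * ∫ y : Perp ω, inner ℝ (p • ω + (y : Space n)) ι ^ k *
        h (p • ω + (y : Space n)) := by
  rw [integral_slice hω (by fun_prop) hi]
  refine integral_congr_ae (Eventually.of_forall fun p => ?_)
  simp only [inner_slice hω]
  rw [integral_const_mul]

/-- Binomial expansion of `(⟨p • ω, ι⟩ + ⟨y, ι⟩) ^ m`: moments about the origin combine those about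
`p • ω`. -/
theorem integral_inner_slice_pow_eq_zero {p : ℝ} {m : ℕ} {ι : Space n}
    (hi : ∀ k ≤ m, Integrable fun y : Perp ω =>
      inner ℝ (y : Space n) ι ^ k * h (p • ω + (y : Space n)))
    (h0 : ∀ k ≤ m, ∫ y : Perp ω, inner ℝ (y : Space n) ι ^ k * h (p • ω + (y : Space n)) = 0) :
    ∫ y : Perp ω, inner ℝ (p • ω + (y : Space n)) ι ^ m * h (p • ω + (y : Space n)) = 0 := by
  have e : ∀ y : Perp ω, inner ℝ (p • ω + (y : Space n)) ι ^ m * h (p • ω + (y : Space n)) =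
      ∑ k ∈ Finset.range (m + 1), (inner ℝ (p • ω) ι ^ (m - k) * m.choose k) *
        (inner ℝ (y : Space n) ι ^ k * h (p • ω + (y : Space n))) := by
    intro y
    rw [inner_add_left, add_comm, add_pow, Finset.sum_mul]
    exact Finset.sum_congr rfl fun k _ => by ring
  have hk : ∀ k ∈ Finset.range (m + 1), k ≤ m := fun k hk => by
    have := Finset.mem_range.mp hk
    omega
  simp_rw [e]
  rw [integral_finsetSum _ fun k hkr => (hi k (hk k hkr)).const_mul _]
  refine Finset.sum_eq_zero fun k hkr => ?_
  rw [integral_const_mul, h0 k (hk k hkr), mul_zero]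

/-! ### Differentiation with respect to the normal direction. -/

theorem enorm_mul_enorm_le {V : Type*} [NormedAddCommGroup V] {x : V} {r q : ℝ} {A : NNReal}
    (hle : ‖x‖ * |r| ≤ A * |q|) : ‖x‖ₑ * ‖r‖ₑ ≤ A * ‖q‖ₑ := by
  have h1 := ENNReal.ofReal_le_ofReal hle
  rwa [ENNReal.ofReal_mul (norm_nonneg _), ENNReal.ofReal_mul A.coe_nonneg, ← Real.norm_eq_abs,
    ← Real.norm_eq_abs, ofReal_norm, ofReal_norm, ofReal_norm, ENNReal.ofReal_coe_nnreal] at h1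

/-- If the moments up to order `m` over all hyperplanes with normals in `W` vanish, then the moment
of order `m + 1` over the hyperplanes orthogonal to `ω`, in a limit direction of `W` at `ω`,
has weak derivative zero with respect to the offset. -/
theorem integral_deriv_mul_moment_eq_zero {W : Set (Space n)} (hW : ∀ ω ∈ W, ‖ω‖ = 1) (hω : ω ∈ W)
    {s : ℕ → Space n} (hs : ∀ᶠ j in atTop, s j ∈ W) (hslim : Tendsto s atTop (𝓝 ω))
    {ι : Space n} (hι : Tendsto (fun j => ‖s j - ω‖⁻¹ • (s j - ω)) atTop (𝓝 ι))
    (hιω : inner ℝ ω ι = 0) (hm : Measurable h) {a b : ℝ}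
    (hc : ∀ p ∈ Set.Icc a b, ∀ x ∈ hyperplane ω p, ContinuousAt h x)
    (hb : ∀ k : ℕ, ∃ C : NNReal, ∀ p ∈ Set.Icc a b, ∀ ω ∈ W,
      ∫⁻ y : Perp ω, ‖‖y‖ ^ k * h (p • ω + (y : Space n))‖ₑ ≤ C) {m : ℕ}
    (h0 : ∀ ω ∈ W, ∀ p ∈ Set.Icc a b, ∀ k ≤ m,
      ∫ y : Perp ω, inner ℝ (y : Space n) ι ^ k * h (p • ω + (y : Space n)) = 0)
    {φ ψ : ℝ → ℝ} (hφ : ∀ t, HasDerivAt φ (ψ t) t) (hψ : Continuous ψ)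
    (hφ0 : ∀ t ∉ Set.Icc a b, φ t = 0) (hψ0 : ∀ t ∉ Set.Icc a b, ψ t = 0) :
    ∫ p, ψ p * ∫ y : Perp ω, inner ℝ (y : Space n) ι ^ (m + 1) *
      h (p • ω + (y : Space n)) = 0 := by
  have hφc : Continuous φ := continuous_iff_continuousAt.mpr fun t => (hφ t).continuousAt
  obtain ⟨L, hL⟩ := (HasCompactSupport.intro isCompact_Icc hψ0).exists_bound_of_continuous hψ
  obtain ⟨L', hL'⟩ := (HasCompactSupport.intro isCompact_Icc hφ0).exists_bound_of_continuous hφc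
  have hL0 : 0 ≤ L := (norm_nonneg _).trans (hL 0)
  have hlip : ∀ u v, |φ u - φ v| ≤ L * |u - v| := fun u v =>
    Convex.norm_image_sub_le_of_norm_hasDerivWithin_le (s := Set.univ)
      (fun t _ => (hφ t).hasDerivWithinAt) (fun t _ => hL t) convex_univ trivial trivial
  have hslab := exists_slab_bound hW hm hb
  have hvanish : ∀ ω ∈ W, Integrable (fun x => φ (inner ℝ x ω) * (inner ℝ x ι ^ m * h x)) ∧
      ∫ x, φ (inner ℝ x ω) * (inner ℝ x ι ^ m * h x) = 0 := by
    intro ω hω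
    obtain ⟨C, hC⟩ := hslab m
    have hi := integrable_slab hφc.measurable hL' hφ0 hm (hC ω hω) ι
    refine ⟨hi, ?_⟩
    rw [integral_slab hφc.measurable hm (hW ω hω) hi, ← integral_zero ℝ ℝ (μ := volume)]
    refine integral_congr_ae (Eventually.of_forall fun p => ?_)
    show φ p * _ = 0
    by_cases hp : p ∈ Set.Icc a b
    · rw [integral_inner_slice_pow_eq_zero (fun k _ => ?_) (h0 ω hω p hp), mul_zero]
      obtain ⟨C', hC'⟩ := hb k
      exact integrable_inner_pow_mul_slice hm (hC' p hp ω hω) ι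
    · rw [hφ0 p hp, zero_mul]
  -- `G j` is the difference quotient between `s j` and `ω`; its integral vanishes once `s j ∈ W`.
  -- Its limit `g` is the derivative in direction `ι`.
  set G : ℕ → Space n → ℝ := fun j x =>
    ‖s j - ω‖⁻¹ * (φ (inner ℝ x (s j)) - φ (inner ℝ x ω)) * (inner ℝ x ι ^ m * h x) with hG
  set g : Space n → ℝ := fun x => ψ (inner ℝ x ω) * (inner ℝ x ι ^ (m + 1) * h x) with hg
  obtain ⟨C₁, hC₁⟩ := hslab (m + 1)
  have hgi : Integrable g := integrable_slab hψ.measurable hL hψ0 hm (hC₁ ω hω) ι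
  have hquot : ∀ j x, |‖s j - ω‖⁻¹ * (φ (inner ℝ x (s j)) - φ (inner ℝ x ω))| ≤ L * ‖x‖ := by
    intro j x
    have h1 : |φ (inner ℝ x (s j)) - φ (inner ℝ x ω)| ≤ L * (‖x‖ * ‖s j - ω‖) := by
      refine (hlip _ _).trans ?_
      rw [← inner_sub_right]
      gcongr
      exact abs_real_inner_le_norm _ _
    rw [abs_mul, abs_inv, abs_norm]
    calc ‖s j - ω‖⁻¹ * |φ (inner ℝ x (s j)) - φ (inner ℝ x ω)|
        ≤ ‖s j - ω‖⁻¹ * (L * (‖x‖ * ‖s j - ω‖)) := by gcongr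
      _ = L * ‖x‖ * (‖s j - ω‖⁻¹ * ‖s j - ω‖) := by ring
      _ ≤ L * ‖x‖ * 1 := by
        gcongr
        exact inv_mul_le_one
      _ = L * ‖x‖ := mul_one _
  have hlim : Tendsto (fun j => ∫ x, G j x) atTop (𝓝 (∫ x, g x)) := by
    -- Order `m + 2`: the Lipschitz bound on the quotient costs one factor `‖x‖`, the tail estimate
    -- another. `G j` lives on two slabs, `g` on one, whence the constant below.
    obtain ⟨C, hC⟩ := hslab (m + 2)
    set D : NNReal := ⟨L, hL0⟩ * ‖ι‖₊ ^ m with hD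
    set D' : NNReal := ⟨L, hL0⟩ * ‖ι‖₊ ^ (m + 1) with hD'
    set Sl : Space n → Space n → ENNReal := fun ω x =>
      {x : Space n | inner ℝ x ω ∈ Set.Icc a b}.indicator (fun x => ‖‖x‖ ^ (m + 2) * h x‖ₑ) x
      with hSl
    have hSlmem : ∀ ω x, inner ℝ x ω ∈ Set.Icc a b → Sl ω x = ‖‖x‖ ^ (m + 2) * h x‖ₑ :=
      fun ω x hx => Set.indicator_of_mem (s := {x : Space n | inner ℝ x ω ∈ Set.Icc a b}) hx _
    have hSlm : ∀ ω, Measurable (Sl ω) := fun ω =>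
      (by fun_prop : Measurable fun x : Space n => ‖‖x‖ ^ (m + 2) * h x‖ₑ).indicator
        (measurableSet_Icc.preimage (by fun_prop : Measurable fun x : Space n => inner ℝ x ω))
    refine tendsto_integral_of_tail_bound (C := D * (C + C) + D' * C) (fun j => ?_) hgi
      (fun x => ?_) (Eventually.of_forall fun x => ?_) ?_ ?_
    · exact (by fun_prop : Measurable _).aestronglyMeasurable
    · by_cases hx : inner ℝ x ω ∈ Set.Icc a b
      · have hcx : ContinuousAt (fun x : Space n => L * ‖x‖ * |inner ℝ x ι ^ m * h x|) x := by
          have := hc _ hx x rfl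
          fun_prop
        refine ⟨L * ‖x‖ * |inner ℝ x ι ^ m * h x| + 1, ?_⟩
        have h1 := hcx.tendsto.eventually (eventually_le_nhds (lt_add_one _))
        filter_upwards [tendsto_snd.eventually h1] with z hz
        refine le_trans ?_ hz
        rw [hG, abs_mul]
        gcongr
        exact hquot _ _
      -- Nothing bounds `h` locally off the closed slab of `ω`, but there both terms of `G j` vanish
      -- near `x` for large `j`.
      · refine ⟨0, ?_⟩
        have hopen : (Set.Icc a b)ᶜ ∈ 𝓝 (inner ℝ x ω : ℝ) :=
          isClosed_Icc.isOpen_compl.mem_nhds hx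
        have t1 : Tendsto (fun z : ℕ × Space n => (inner ℝ z.2 (s z.1) : ℝ)) (atTop ×ˢ 𝓝 x)
            (𝓝 (inner ℝ x ω)) := tendsto_snd.inner (hslim.comp tendsto_fst)
        have t2 : Tendsto (fun z : ℕ × Space n => (inner ℝ z.2 ω : ℝ)) (atTop ×ˢ 𝓝 x)
            (𝓝 (inner ℝ x ω)) := tendsto_snd.inner tendsto_const_nhds
        filter_upwards [t1 hopen, t2 hopen] with z hz1 hz2
        simp [hG, hφ0 _ hz1, hφ0 _ hz2]
    · have t1 : Tendsto (fun j => (inner ℝ x (s j - ω) : ℝ)) atTop (𝓝 0) := by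
        have : Tendsto (fun j => s j - ω) atTop (𝓝 0) := by
          simpa using hslim.sub_const ω
        simpa using Filter.Tendsto.inner (𝕜 := ℝ) (tendsto_const_nhds (x := x)) this
      have t2 : Tendsto (fun j => ‖s j - ω‖⁻¹ • (inner ℝ x (s j - ω) : ℝ)) atTop
          (𝓝 (inner ℝ x ι)) := by
        have := Filter.Tendsto.inner (𝕜 := ℝ) (tendsto_const_nhds (x := x)) hι
        simpa only [real_inner_smul_right, smul_eq_mul] using this
      have t3 := ((hφ (inner ℝ x ω)).hasFDerivAt.hasFDerivWithinAt (s := Set.univ)).lim t1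
        (by simp) t2
      have t4 := t3.mul_const (inner ℝ x ι ^ m * h x)
      have e : g x = (ContinuousLinearMap.toSpanSingleton ℝ (ψ (inner ℝ x ω))) (inner ℝ x ι) *
          (inner ℝ x ι ^ m * h x) := by
        simp only [hg, ContinuousLinearMap.toSpanSingleton_apply, smul_eq_mul]
        ring
      rw [e]
      refine t4.congr fun j => ?_
      simp only [hG, inner_sub_right, smul_eq_mul, add_sub_cancel]
    · filter_upwards [hs] with j hj
      have hpt : ∀ x, ‖x‖ₑ * ‖G j x‖ₑ ≤ D * (Sl (s j) x + Sl ω x) := by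
        intro x
        by_cases hx : inner ℝ x (s j) ∈ Set.Icc a b ∨ inner ℝ x ω ∈ Set.Icc a b
        · have h1 : ‖x‖ₑ * ‖G j x‖ₑ ≤ D * ‖‖x‖ ^ (m + 2) * h x‖ₑ := by
            refine enorm_mul_enorm_le ?_
            have h2 := abs_inner_pow_mul_le x ι m (h x)
            have h3 := hquot j x
            rw [hG, abs_mul, abs_mul (‖x‖ ^ (m + 2)), abs_pow, abs_norm]
            rw [abs_mul (‖x‖ ^ m), abs_pow, abs_norm] at h2
            calc _ ≤ ‖x‖ * ((L * ‖x‖) * (‖ι‖ ^ m * (‖x‖ ^ m * |h x|))) := by gcongr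
              _ = (L * ‖ι‖ ^ m) * (‖x‖ ^ (m + 2) * |h x|) := by ring
              _ = _ := by rw [hD]; rfl
          refine h1.trans ?_
          gcongr
          rcases hx with hx | hx
          · refine le_trans (le_of_eq ?_) le_self_add
            exact (hSlmem _ x hx).symm
          · refine le_trans (le_of_eq ?_) le_add_self
            exact (hSlmem _ x hx).symm
        · rw [not_or] at hx
          simp [hG, hφ0 _ hx.1, hφ0 _ hx.2]
      refine (lintegral_mono hpt).trans ?_
      rw [lintegral_const_mul' _ _ ENNReal.coe_ne_top, lintegral_add_left (hSlm _),
        ENNReal.coe_add, ENNReal.coe_mul, ENNReal.coe_add]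
      refine le_trans ?_ le_self_add
      gcongr
      · exact hC _ hj
      · exact hC _ hω
    · have hpt : ∀ x, ‖x‖ₑ * ‖g x‖ₑ ≤ D' * Sl ω x := by
        intro x
        by_cases hx : inner ℝ x ω ∈ Set.Icc a b
        · rw [hSlmem _ x hx]
          refine enorm_mul_enorm_le ?_
          have h2 := abs_inner_pow_mul_le x ι (m + 1) (h x)
          have h3 : |ψ (inner ℝ x ω)| ≤ L := hL _
          rw [hg, abs_mul, abs_mul (‖x‖ ^ (m + 2)), abs_pow, abs_norm]
          rw [abs_mul (‖x‖ ^ (m + 1)), abs_pow, abs_norm] at h2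
          calc _ ≤ ‖x‖ * (L * (‖ι‖ ^ (m + 1) * (‖x‖ ^ (m + 1) * |h x|))) := by gcongr
            _ = (L * ‖ι‖ ^ (m + 1)) * (‖x‖ ^ (m + 2) * |h x|) := by ring
            _ = _ := by rw [hD']; rfl
        · simp [hg, hψ0 _ hx]
      refine (lintegral_mono hpt).trans ?_
      rw [lintegral_const_mul' _ _ ENNReal.coe_ne_top, ENNReal.coe_add, ENNReal.coe_mul D' C]
      refine le_trans ?_ le_add_self
      gcongr
      exact hC _ hω
  have hzero : ∀ᶠ j in atTop, ∫ x, G j x = 0 := by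
    filter_upwards [hs] with j hj
    have e : ∀ x, G j x = ‖s j - ω‖⁻¹ * (φ (inner ℝ x (s j)) * (inner ℝ x ι ^ m * h x) -
        φ (inner ℝ x ω) * (inner ℝ x ι ^ m * h x)) := fun x => by
      simp only [hG]; ring
    simp_rw [e]
    rw [integral_const_mul, integral_sub (hvanish _ hj).1 (hvanish _ hω).1, (hvanish _ hj).2,
      (hvanish _ hω).2, sub_zero, mul_zero]
  have hfin : ∫ x, g x = 0 :=
    tendsto_nhds_unique hlim (tendsto_const_nhds.congr' (hzero.mono fun j hj => hj.symm))
  rw [integral_slab hψ.measurable hm (hW ω hω) hgi] at hfin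
  -- Since `ι` is tangent at `ω`, `⟨p • ω + y, ι⟩ = ⟨y, ι⟩`.
  simpa only [inner_add_left, real_inner_smul_left, hιω, mul_zero, zero_add] using hfin

/-! ### A measurable replacement for `f`, and tangency of limit directions. -/

/-- `f` truncated to the open set around whose points it is continuously differentiable. -/
noncomputable def smoothPart (f : Space n → ℝ) : Space n → ℝ :=
  {x | ContDiffAt ℝ 1 f x}.indicator f

theorem smoothPart_eq {f : Space n → ℝ} {x : Space n} (hx : ContDiffAt ℝ 1 f x) :
    smoothPart f x = f x := Set.indicator_of_mem (s := {x | ContDiffAt ℝ 1 f x}) hx f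

theorem isOpen_setOf_contDiffAt (f : Space n → ℝ) : IsOpen {x | ContDiffAt ℝ 1 f x} :=
  isOpen_iff_eventually.mpr fun x hx =>
    ContDiffAt.eventually (show ContDiffAt ℝ 1 f x from hx) (by simp)

theorem continuousAt_smoothPart {f : Space n → ℝ} {x : Space n} (hx : ContDiffAt ℝ 1 f x) :
    ContinuousAt (smoothPart f) x :=
  hx.continuousAt.congr <| ((isOpen_setOf_contDiffAt f).eventually_mem hx).mono fun _ hy =>
    (smoothPart_eq hy).symm

/-- Being continuous on an open set and zero elsewhere, the truncation is measurable although `f` is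
arbitrary. This permits Fubini on `ℝⁿ`. -/
theorem measurable_smoothPart (f : Space n → ℝ) : Measurable (smoothPart f) := by
  classical
  rw [smoothPart, ← Set.piecewise_eq_indicator]
  exact ContinuousOn.measurable_piecewise
    (fun x hx => (show ContDiffAt ℝ 1 f x from hx).continuousAt.continuousWithinAt)
    continuousOn_const (isOpen_setOf_contDiffAt f).measurableSet

/-- Limit directions are tangent to the sphere. -/
theorem inner_eq_zero_of_mem_limitDirections {Ω : Set (Space n)} (hΩ : Ω ⊆ Metric.sphere 0 1)
    {ω ι : Space n} (hω : ω ∈ Ω) (hι : ι ∈ limitDirections Ω ω) : inner ℝ ω ι = 0 := by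
  obtain ⟨s, hs, hslim, hq⟩ := hι
  have h1 : ∀ ω ∈ Ω, ‖ω‖ = 1 := fun ω hω => mem_sphere_zero_iff_norm.mp (hΩ hω)
  have h2 := Filter.Tendsto.inner (𝕜 := ℝ) (tendsto_const_nhds (x := ω)) hq
  refine tendsto_nhds_unique h2 ?_
  -- On the unit sphere `⟨ω, s - ω⟩ = -‖s - ω‖² / 2`.
  have h3 : ∀ k, inner ℝ ω (‖s k - ω‖⁻¹ • (s k - ω)) = -(‖s k - ω‖ / 2) := by
    intro k
    have hne : ‖s k - ω‖ ≠ 0 := norm_ne_zero_iff.mpr (sub_ne_zero.mpr (hs k).2)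
    have h4 := norm_sub_sq_real (s k) ω
    rw [h1 _ (hs k).1, h1 _ hω, real_inner_comm] at h4
    rw [real_inner_smul_right, inner_sub_right, real_inner_self_eq_norm_sq, h1 _ hω,
      inv_mul_eq_div, div_eq_iff hne]
    linarith
  simp_rw [h3]
  have h5 : Tendsto (fun k => ‖s k - ω‖) atTop (𝓝 0) := by
    simpa using (hslim.sub_const ω).norm
  simpa using (h5.div_const 2).neg

/-! ### Induction on the order of the moments. -/

/-- If all moments up to order `m` vanish near `ω`, then the moments of order `m + 1` over the
hyperplanes orthogonal to `ω` do not depend on the offset. -/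
theorem moment_eq_of_lower_moments_eq_zero {Ω U : Set (Space n)} {J : Set ℝ}
    (hΩ : Ω ⊆ Metric.sphere 0 1) {ω : Space n} (hω : ω ∈ Ω) (hU : IsOpen U) (hωU : ω ∈ U)
    (hI : ZariskiDenseAt ω (limitDirections Ω ω)) (hJ : J.OrdConnected) {h : Space n → ℝ}
    (hm : Measurable h)
    (hc : ∀ p ∈ J, ∀ x ∈ hyperplane ω p, ContinuousAt h x)
    (hb : ∀ p ∈ J, ∀ k : ℕ, ∃ ε > 0, ∃ C : NNReal, ∀ p' ∈ J, |p' - p| < ε → ∀ ω ∈ Ω ∩ U,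
      ∫⁻ y : Perp ω, ‖‖y‖ ^ k * h (p' • ω + (y : Space n))‖ₑ ≤ C) {m : ℕ}
    (h0 : ∀ ω ∈ Ω ∩ U, ∀ p ∈ J, ∀ k ≤ m, ∀ η : Space n,
      ∫ y : Perp ω, inner ℝ (y : Space n) η ^ k * h (p • ω + (y : Space n)) = 0)
    (η : Perp ω) {u v : ℝ} (hu : u ∈ J) (hv : v ∈ J) :
    ∫ y : Perp ω, inner ℝ (y : Space n) (η : Space n) ^ (m + 1) * h (u • ω + (y : Space n)) =
      ∫ y : Perp ω, inner ℝ (y : Space n) (η : Space n) ^ (m + 1) *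
        h (v • ω + (y : Space n)) := by
  wlog huv : u < v generalizing u v
  · rcases (not_lt.mp huv).eq_or_lt with rfl | h1
    · rfl
    · exact (this hv hu h1).symm
  have hn1 : ∀ ω ∈ Ω ∩ U, ‖ω‖ = 1 := fun ω hω => mem_sphere_zero_iff_norm.mp (hΩ hω.1)
  have hωW : ω ∈ Ω ∩ U := ⟨hω, hωU⟩
  have hsub : Set.Icc u v ⊆ J := hJ.out hu hv
  have hunif : ∀ k : ℕ, ∃ C : NNReal, ∀ p ∈ Set.Icc u v, ∀ ω ∈ Ω ∩ U,
      ∫⁻ y : Perp ω, ‖‖y‖ ^ k * h (p • ω + (y : Space n))‖ₑ ≤ C := fun k =>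
    exists_uniform_bound (fun p hp => hb p hp k) isCompact_Icc hsub
  have hpoly : ∀ p ∈ J, ∃ P : MvPolynomial (Fin n) ℝ, P.IsHomogeneous (m + 1) ∧ ∀ η : Space n,
      MvPolynomial.eval (fun i => η i) P = ∫ y : Perp ω, inner ℝ (y : Space n) η ^ (m + 1) *
        h (p • ω + (y : Space n)) := by
    intro p hp
    obtain ⟨ε, hε, C, hC⟩ := hb p hp (m + 1)
    exact exists_isHomogeneous_moment (Y := fun y : Perp ω => (y : Space n)) (by fun_prop)
      (by fun_prop : Measurable _).aestronglyMeasurable _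
      (integrable_norm_pow_mul_slice hm (hC p hp (by simpa using hε) ω hωW))
  obtain ⟨P, hP, hPe⟩ := hpoly u hu
  obtain ⟨Q, hQ, hQe⟩ := hpoly v hv
  -- Equality at the two offsets is only needed for limit directions, where the weak derivative is
  -- available.
  have hz := hI (m + 1) (P - Q) (hP.sub hQ) ?_ η η.2
  · rw [map_sub, hPe, hQe, sub_eq_zero] at hz
    exact hz
  intro ι hι
  rw [map_sub, hPe, hQe, sub_eq_zero]
  have hιω := inner_eq_zero_of_mem_limitDirections hΩ hω hι
  obtain ⟨s, hs, hslim, hq⟩ := hι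
  refine eq_of_integral_deriv_mul_eq_zero (N := fun p => ∫ y : Perp ω,
    inner ℝ (y : Space n) ι ^ (m + 1) * h (p • ω + (y : Space n))) huv ?_ ?_
  · refine ContinuousOn.mono (continuousOn_moment (hn1 ω hωW) hm hc (fun p hp k => ?_) _ _) hsub
    obtain ⟨ε, hε, C, hC⟩ := hb p hp k
    exact ⟨ε, hε, C, fun p' hp' hd => hC p' hp' hd ω hωW⟩
  · intro φ ψ hφ hψ hφ0 hψ0
    refine integral_deriv_mul_moment_eq_zero hn1 hωW ?_ hslim hq hιω hm
      (fun p hp => hc p (hsub hp)) hunif (fun ω hω p hp k hk => h0 ω hω p (hsub hp) k hk ι)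
      hφ hψ hφ0 hψ0
    filter_upwards [hslim (hU.mem_nhds hωU)] with j hj using ⟨(hs j).1, hj⟩

/-- All moments of `f` over the hyperplanes that avoid `K` and have a normal in `Ω` vanish. -/
theorem moment_eq_zero {Ω K : Set (Space n)} (hΩ : Ω ⊆ Metric.sphere 0 1)
    (hI : ∀ ω ∈ Ω, ZariskiDenseAt ω (limitDirections Ω ω)) {f : Space n → ℝ}
    (hf : DecayConditions f Ω K)
    (hR : ∀ ω ∈ Ω, ∀ p : ℝ, Disjoint (hyperplane ω p) K → radon f ω p = 0) (m : ℕ) :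
    ∀ ω ∈ Ω, ∀ p : ℝ, Disjoint (hyperplane ω p) K → ∀ η : Space n,
      ∫ y : Perp ω, inner ℝ (y : Space n) η ^ m * f (p • ω + (y : Space n)) = 0 := by
  induction m using Nat.strong_induction_on with
  | _ m ih =>
  rcases m with _ | m
  · intro ω hω p hp η
    simpa [radon] using hR ω hω p hp
  intro ω hω p hp η
  obtain ⟨U, J, hU, hωU, hJ, -, hpJ, hdisj, hD⟩ := hf ω hω p hp
  have hn1 : ∀ ω ∈ Ω ∩ U, ‖ω‖ = 1 := fun ω hω => mem_sphere_zero_iff_norm.mp (hΩ hω.1)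
  have hωW : ω ∈ Ω ∩ U := ⟨hω, hωU⟩
  have heq : ∀ ω ∈ Ω ∩ U, ∀ q ∈ J, ∀ y : Perp ω,
      smoothPart f (q • ω + (y : Space n)) = f (q • ω + (y : Space n)) := fun ω hω q hq y =>
    smoothPart_eq (hD.contDiffAt ω hω q hq _ (slice_mem_hyperplane (hn1 ω hω) q y))
  -- Only the tangential part of `η` enters, and (e) concerns tangential directions.
  set η' : Perp ω := (Perp ω).orthogonalProjectionOnto η with hη'
  have hinner : ∀ y : Perp ω, inner ℝ (y : Space n) η = inner ℝ y η' := fun y =>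
    (Submodule.inner_orthogonalProjectionOnto_eq_of_mem_left y η).symm
  simp_rw [hinner]
  have hconst : ∀ q ∈ J, ∫ y : Perp ω, inner ℝ y η' ^ (m + 1) * f (q • ω + (y : Space n)) =
      ∫ y : Perp ω, inner ℝ y η' ^ (m + 1) * f (p • ω + (y : Space n)) := by
    intro q hq
    have h1 := moment_eq_of_lower_moments_eq_zero (m := m) hΩ hω hU hωU (hI ω hω) hJ
      (measurable_smoothPart f)
      (fun q hq x hx => continuousAt_smoothPart (hD.contDiffAt ω hωW q hq x hx)) ?_ ?_ η' hq hpJ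
    · simp_rw [heq ω hωW q hq, heq ω hωW p hpJ] at h1
      exact h1
    · intro q hq k
      obtain ⟨ε, hε, C, hC⟩ := hD.decay q hq k
      refine ⟨ε, hε, C, fun q' hq' hd ω' hω' => ?_⟩
      simp_rw [heq ω' hω' q' hq']
      exact hC q' hq' hd ω' hω'
    · intro ω' hω' q hq k hk ξ
      simp_rw [heq ω' hω' q hq]
      exact ih k (by omega) ω' hω'.1 q (hdisj ω' hω' q hq) ξ
  rcases hD.moment (m + 1) η' with ⟨q, hq, h0⟩ | ⟨q, hq, -, -, hlim⟩
  · rw [← hconst q hq, h0]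
  · refine tendsto_nhds_unique ?_ hlim
    simp_rw [fun j => hconst (q j) (hq j)]
    exact tendsto_const_nhds

end RadonSupport

/-! ### Vanishing on each admissible hyperplane. -/

theorem mainTheorem7 (n : ℕ) (hn : 2 ≤ n)
    (Ω : Set (RadonSupport.Space n)) (hΩ : Ω ⊆ Metric.sphere 0 1) (hperf : Preperfect Ω)
    (hI : ∀ ω ∈ Ω, RadonSupport.ZariskiDenseAt ω (RadonSupport.limitDirections Ω ω))
    (K : Set (RadonSupport.Space n)) (hK : IsClosed K)
    (f : RadonSupport.Space n → ℝ) (hf : RadonSupport.DecayConditions f Ω K)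
    (hR : ∀ ω ∈ Ω, ∀ p : ℝ, Disjoint (RadonSupport.hyperplane ω p) K →
      RadonSupport.radon f ω p = 0) :
    ∀ x ∈ RadonSupport.sharp Ω K, f x = 0 := by
  rintro x ⟨ω, hω, p, hp, hx⟩
  have hω1 : ‖ω‖ = 1 := mem_sphere_zero_iff_norm.mp (hΩ hω)
  obtain ⟨U, J, -, hωU, -, -, hpJ, -, hD⟩ := hf ω hω p hp
  have hcont := RadonSupport.continuous_comp_slice hω1 fun x hx =>
    (hD.contDiffAt ω ⟨hω, hωU⟩ p hpJ x hx).continuousAt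
  obtain ⟨μ, hμ, hexp⟩ := hD.exp_decay p hpJ
  have hzero := RadonSupport.eq_zero_of_moments_eq_zero hcont hμ
    ⟨(hcont.mul (by fun_prop)).aestronglyMeasurable, hexp⟩ fun k η =>
      RadonSupport.moment_eq_zero hΩ hI hf hR k ω hω p hp (η : RadonSupport.Space n)
  have hmem : x - p • ω ∈ RadonSupport.Perp ω := by
    rw [Submodule.mem_orthogonal_singleton_iff_inner_right, inner_sub_right, real_inner_comm,
      show inner ℝ x ω = p from hx, real_inner_smul_right, real_inner_self_eq_norm_sq, hω1]
    simp
  have h1 := congrFun hzero ⟨x - p • ω, hmem⟩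
  simpa using h1
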